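/- Let $\Bbbk$ be a totally ordered division ring (not necessarily commutative), and let $J$ be a set with a subset $I\subseteq J$. Denote by $\Bbbk^{(J)}$ the set of all finitely supported families $(x_j)_{j\in J}$ of elements of $\Bbbk$, and identify $\Bbbk^{(I)}$ with the set of all elements of $\Bbbk^{(J)}$ whose support is contained in $I$. Each $a\in\Bbbk^{(J)}$ is identified with the linear functional $x\mapsto\sum_{j\in J}a_jx_j$ on the right $\Bbbk$-vector space $\Bbbk^{(J)}$. For $\mathcal{F}\subseteq\Bbbk^{(J)}$, let $\operatorname{Op}^-(\mathcal{F},\Bbbk^{(J)})$ be the sublattice of the powerset of $\Bbbk^{(J)}$ generated by all sets $\{x\in\Bbbk^{(J)} : a(x)>0\}$ and $\{x\in\Bbbk^{(J)} : a(x)<0\}$ with $a\in\mathcal{F}$, and set $\operatorname{Op}(\mathcal{F},\Bbbk^{(J)})=\operatorname{Op}^-(\mathcal{F},\Bbbk^{(J)})\cup\{\Bbbk^{(J)}\}$. A $0$-lattice is a lattice with a least element $0$; a $0$-lattice homomorphism is a lattice homomorphism preserving $0$. A $0$-lattice $L$ is completely normal if for all $a,b\in L$ there are $u,v\in L$ with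 $a\leq u\vee b$, $b\leq a\vee v$, and $u\wedge v=0$. Denote by $L\cup\{\infty\}$ the lattice obtained by adding a new top element $\infty$ to $L$. A map $f\colon P\to Q$ between posets with top elements $\top_P$, $\top_Q$ is top-faithful if $f^{-1}\{\top_Q\}=\{\top_P\}$. Let $L$ be a completely normal distributive $0$-lattice, let $\mathcal{D}$ be a finite subset of $\Bbbk^{(J)}$, and let $e\in\Bbbk^{(J)}$. Then every top-faithful $0$-lattice homomorphism $f\colon\operatorname{Op}(\Bbbk^{(I)}\cup\mathcal{D},\Bbbk^{(J)})\to L\cup\{\infty\}$ extends to a top-faithful lattice homomorphism $g\colon\operatorname{Op}(\Bbbk^{(I)}\cup\mathcal{D}\cup\{e\},\Bbbk^{(J)})\to L\cup\{\infty\}$. -/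

import Mathlib

/-- Two elements `a`, `b` of a lattice with zero are consonant if there are `u`, `v` with
`a ≤ u ∨ b`, `b ≤ a ∨ v` and `u ∧ v = 0`. -/
def Consonant {L : Type*} [Lattice L] [OrderBot L] (a b : L) : Prop :=
  ∃ u v : L, a ≤ u ⊔ b ∧ b ≤ a ⊔ v ∧ u ⊓ v = ⊥

/-- A lattice with zero is completely normal if any two of its elements are consonant. -/
def CompletelyNormal (L : Type*) [Lattice L] [OrderBot L] : Prop :=
  ∀ a b : L, Consonant a b

/-- A map between posets with top is top-faithful if the inverse image of the top element consists
exactly of the top element. -/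
def TopFaithful {P Q : Type*} [PartialOrder P] [OrderTop P] [PartialOrder Q] [OrderTop Q]
    (f : P → Q) : Prop :=
  f ⁻¹' {⊤} = {⊤}

section Op

variable {Ω 𝕜 : Type*} [Zero 𝕜] [LT 𝕜]

/-- The sublattice `Op⁻(ℱ, Ω)` of the powerset of `Ω` generated by all sets `{f > 0}` and
`{f < 0}`, for `f ∈ ℱ`. -/
def OpMinus (F : Set (Ω → 𝕜)) : Sublattice (Set Ω) where
  carrier := latticeClosure {X | ∃ f ∈ F, X = {x | 0 < f x} ∨ X = {x | f x < 0}}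
  supClosed' := isSublattice_latticeClosure.supClosed
  infClosed' := isSublattice_latticeClosure.infClosed

/-- The lattice `Op(ℱ, Ω) = Op⁻(ℱ, Ω) ∪ {Ω}`. -/
def Op (F : Set (Ω → 𝕜)) : Sublattice (Set Ω) where
  carrier := (OpMinus F : Set (Set Ω)) ∪ {Set.univ}
  supClosed' := by
    rintro X (hX | rfl) Y (hY | rfl)
    · exact Or.inl ((OpMinus F).supClosed hX hY)
    · exact Or.inr (by simp)
    · exact Or.inr (by simp)
    · exact Or.inr (by simp)
  infClosed' := by
    rintro X (hX | rfl) Y (hY | rfl)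
    · exact Or.inl ((OpMinus F).infClosed hX hY)
    · exact Or.inl (by simpa using hX)
    · exact Or.inl (by simpa using hY)
    · exact Or.inr (by simp)

theorem Op_mono {F G : Set (Ω → 𝕜)} (h : F ⊆ G) : Op F ≤ Op G := by
  rintro X (hX | hX)
  · refine Or.inl (latticeClosure_mono ?_ hX)
    rintro Y ⟨f, hf, hY⟩
    exact ⟨f, h hf, hY⟩
  · exact Or.inr hX

theorem univ_mem_Op (F : Set (Ω → 𝕜)) : (Set.univ : Set Ω) ∈ Op F := Or.inr rfl

end Op

section Functionals

variable {𝕜 J : Type*} [DivisionRing 𝕜]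

/-- The linear functional `x ↦ ∑ j, a j * x j` on the right vector space `𝕜^(J)` associated to
`a ∈ 𝕜^(J)`. -/
def linFunctional (a : J →₀ 𝕜) : (J →₀ 𝕜) → 𝕜 :=
  fun x => a.sum fun j c => c * x j

/-- For `I ⊆ J`, the set `𝕜^(I)`, seen as the set of all vectors in `𝕜^(J)` with support
contained in `I`. -/
def kkp (𝕜 : Type*) {J : Type*} [DivisionRing 𝕜] (I : Set J) : Set (J →₀ 𝕜) :=
  {a | (a.support : Set J) ⊆ I}

variable [LinearOrder 𝕜]

/-- The lattice `Op(𝕜^(I) ∪ D, 𝕜^(J))`, where the elements of `𝕜^(I) ∪ D` are identified with the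
associated linear functionals on `𝕜^(J)`. -/
def OpK (I : Set J) (D : Set (J →₀ 𝕜)) : Sublattice (Set (J →₀ 𝕜)) :=
  Op (linFunctional '' (kkp 𝕜 I ∪ D))

theorem OpK_mono (I : Set J) {D D' : Set (J →₀ 𝕜)} (h : D ⊆ D') : OpK I D ≤ OpK I D' :=
  Op_mono (Set.image_mono (Set.union_subset_union_right _ h))

theorem empty_mem_OpK (I : Set J) (D : Set (J →₀ 𝕜)) : (∅ : Set (J →₀ 𝕜)) ∈ OpK I D := by
  refine Or.inl (subset_latticeClosure ⟨linFunctional 0, ⟨0, Or.inl ?_, rfl⟩, Or.inl ?_⟩)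
  · simp [kkp]
  · simp [linFunctional]

/-- The bottom of `Op(𝕜^(I) ∪ D, 𝕜^(J))` is the empty set and its top is `𝕜^(J)`. -/
instance instBoundedOrderOpK (I : Set J) (D : Set (J →₀ 𝕜)) : BoundedOrder (OpK I D) where
  top := ⟨Set.univ, univ_mem_Op _⟩
  le_top X := Set.subset_univ (X : Set (J →₀ 𝕜))
  bot := ⟨∅, empty_mem_OpK I D⟩
  bot_le X := Set.empty_subset (X : Set (J →₀ 𝕜))

end Functionals

/-! ### Linear functionals on the right vector space. -/

section Functional

variable {𝕜 J : Type*} [DivisionRing 𝕜]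

/-! Let P = {e > 0} and N = {e < 0}. Every set of the larger lattice is X ∪ (Y ∩ P) ∪ (Z ∩ N) with
X, Y, Z in the smaller one, so extending f amounts to choosing disjoint values a, b for P, N
compatible with all inclusions (`LatticeHom.exists_extension`).

These infinitely many constraints reduce to finitely many. By Fourier–Motzkin elimination
(`exists_finset_signEquiv`) only the cells of a finite arrangement F matter, namely those on which e
has a constant nonzero sign. Such a cell is A \ B, its open star minus the boundary of that star.
The lower bounds on a become f(A) ≤ a ∨ f(B) for the positive cells. The upper bounds follow from a
≤ ⋁ f(A), because e is positive somewhere on every sign class modulo 𝕜^(I) ∪ D that meets the star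
of a positive cell (`exists_signEquiv_of_mem_openStar`). The same holds for b and negative cells.
Stars of cells of opposite sign meet only inside both boundaries, so complete normality yields
disjoint a and b (`exists_disjoint_differences`). Inclusions involving P ∪ N use convexity of sign
classes (`SignEquiv.exists_eq_zero`).

None of these stars contains the origin, so top-faithfulness of f keeps a and b below ∞, which makes
g top-faithful. -/

theorem linFunctional_smul (c : 𝕜) (a x : J →₀ 𝕜) :
    linFunctional (c • a) x = c * linFunctional a x := by
  simp only [linFunctional]
  rw [Finsupp.sum_smul_index (by simp), Finsupp.mul_sum]
  simp [mul_assoc]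

theorem linFunctional_sub (a b x : J →₀ 𝕜) :
    linFunctional (a - b) x = linFunctional a x - linFunctional b x :=
  Finsupp.sum_sub_index (by simp [sub_mul])

theorem linFunctional_apply_add (a x y : J →₀ 𝕜) :
    linFunctional a (x + y) = linFunctional a x + linFunctional a y := by
  simp [linFunctional, mul_add, Finsupp.sum_add]

theorem linFunctional_apply_op_smul (a x : J →₀ 𝕜) (c : 𝕜) :
    linFunctional a (MulOpposite.op c • x) = linFunctional a x * c := by
  simp [linFunctional, Finsupp.sum_mul, mul_assoc]

theorem linFunctional_apply_zero (a : J →₀ 𝕜) : linFunctional a 0 = 0 := by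
  simp [linFunctional]

theorem linFunctional_apply_single (a : J →₀ 𝕜) (j : J) (t : 𝕜) :
    linFunctional a (Finsupp.single j t) = a j * t := by
  classical
  simp only [linFunctional, Finsupp.sum, Finsupp.single_apply]
  rw [Finset.sum_eq_single j]
  · simp
  · intro i _ hi
    simp [Ne.symm hi]
  · intro hj
    simp [Finsupp.notMem_support_iff.mp hj]

/-- Vectors that differ only outside the support of a functional have the same image. -/
theorem linFunctional_congr {a x y : J →₀ 𝕜} (h : ∀ j, a j ≠ 0 → x j = y j) :
    linFunctional a x = linFunctional a y :=
  Finset.sum_congr rfl fun j hj => congrArg (a j * ·) (h j (Finsupp.mem_support_iff.mp hj))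

end Functional

/-! ### Sign classes: elimination, perturbation, convexity. -/

section SignEquiv

variable {𝕜 J : Type*} [DivisionRing 𝕜] [LinearOrder 𝕜]

/-- Two vectors are sign equivalent with respect to a set of functionals if every functional in
that set takes values of the same sign on both. -/
def SignEquiv (F : Set (J →₀ 𝕜)) (x y : J →₀ 𝕜) : Prop :=
  ∀ d ∈ F, SignType.sign (linFunctional d x) = SignType.sign (linFunctional d y)

namespace SignEquiv

variable {F G : Set (J →₀ 𝕜)} {x y z : J →₀ 𝕜}

theorem refl (x : J →₀ 𝕜) : SignEquiv F x x := fun _ _ => rfl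

theorem symm (h : SignEquiv F x y) : SignEquiv F y x := fun d hd => (h d hd).symm

theorem trans (h : SignEquiv F x y) (h' : SignEquiv F y z) : SignEquiv F x z :=
  fun d hd => (h d hd).trans (h' d hd)

theorem mono (hFG : F ⊆ G) (h : SignEquiv G x y) : SignEquiv F x y := fun d hd => h d (hFG hd)

end SignEquiv

variable [IsStrictOrderedRing 𝕜]

/-- An ordered division ring, commutative or not, is densely ordered. -/
theorem DivisionRing.denselyOrdered (𝕜 : Type*) [DivisionRing 𝕜] [LinearOrder 𝕜]
    [IsStrictOrderedRing 𝕜] : DenselyOrdered 𝕜 where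
  dense a b hab := by
    have h2 : (0 : 𝕜) < 2⁻¹ := inv_pos.mpr two_pos
    have hhalf : ∀ c : 𝕜, (c + c) * 2⁻¹ = c := fun c => by
      rw [← mul_two, mul_inv_cancel_right₀ two_ne_zero]
    refine ⟨(a + b) * 2⁻¹, ?_, ?_⟩
    · conv_lhs => rw [← hhalf a]
      exact mul_lt_mul_of_pos_right (by gcongr) h2
    · conv_rhs => rw [← hhalf b]
      exact mul_lt_mul_of_pos_right (by gcongr) h2

/-- A finite order pattern realized by `s` and a point `v` can be completed for any `r` that has the
same pattern as `s`. -/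
theorem exists_sign_sub_eq {ι : Type*} (A : Finset ι) (r s : ι → 𝕜) (v : 𝕜)
    (h : ∀ i ∈ A, ∀ j ∈ A, SignType.sign (r i - r j) = SignType.sign (s i - s j)) :
    ∃ t, ∀ i ∈ A, SignType.sign (t - r i) = SignType.sign (v - s i) := by
  classical
  -- If v is some s j, then t = r j is forced. Otherwise v cuts the values of s in two, and density
  -- gives t in the corresponding cut of the values of r.
  by_cases hv : ∃ j ∈ A, s j = v
  · obtain ⟨j, hj, rfl⟩ := hv
    exact ⟨r j, fun i hi => h j hj i hi⟩
  push Not at hv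
  have := DivisionRing.denselyOrdered 𝕜
  obtain ⟨t, ht₁, ht₂⟩ := Order.exists_between_finsets
    ((A.filter fun i => s i < v).image r) ((A.filter fun i => v < s i).image r) (by
      simp only [Finset.mem_image, Finset.mem_filter]
      rintro _ ⟨i, ⟨hi, hiv⟩, rfl⟩ _ ⟨j, ⟨hj, hjv⟩, rfl⟩
      have hs := h i hi j hj
      rw [sign_neg (sub_neg.mpr (hiv.trans hjv)), sign_eq_neg_one_iff] at hs
      exact sub_neg.mp hs)
  refine ⟨t, fun i hi => ?_⟩
  rcases lt_or_gt_of_ne (hv i hi) with hlt | hgt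
  · rw [sign_pos (sub_pos.mpr hlt), sign_pos (sub_pos.mpr (ht₁ _ (Finset.mem_image_of_mem _
      (Finset.mem_filter.mpr ⟨hi, hlt⟩))))]
  · rw [sign_neg (sub_neg.mpr hgt), sign_neg (sub_neg.mpr (ht₂ _ (Finset.mem_image_of_mem _
      (Finset.mem_filter.mpr ⟨hi, hgt⟩))))]

/-- Elimination of one coordinate. -/
theorem exists_eliminate_coordinate (G : Finset (J →₀ 𝕜)) (j : J) :
    ∃ C : Finset (J →₀ 𝕜), (∀ c ∈ C, c j = 0) ∧
      (∀ i, (∀ g ∈ G, g i = 0) → ∀ c ∈ C, c i = 0) ∧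
      ∀ x y, SignEquiv (C : Set (J →₀ 𝕜)) x y →
        ∃ x' : J →₀ 𝕜, (∀ i, i ≠ j → x' i = x i) ∧ SignEquiv (G : Set (J →₀ 𝕜)) x' y := by
  classical
  let n : (J →₀ 𝕜) → (J →₀ 𝕜) := fun g => (g j)⁻¹ • g
  let G₁ := G.filter fun g => g j ≠ 0
  have hn : ∀ g ∈ G₁, n g j = 1 := fun g hg => by
    simp [n, inv_mul_cancel₀ (Finset.mem_filter.mp hg).2]
  -- With coefficient 1 at j, the sign of n g at x compares x j with a threshold independent of x j;
  -- the differences n g - n h compare these thresholds.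
  refine ⟨(G.filter fun g => g j = 0) ∪ Finset.image₂ (fun g h => n g - n h) G₁ G₁, ?_, ?_, ?_⟩
  · intro c hc
    rcases Finset.mem_union.mp hc with hc | hc
    · exact (Finset.mem_filter.mp hc).2
    · obtain ⟨g, hg, h, hh, rfl⟩ := Finset.mem_image₂.mp hc
      simp [hn g hg, hn h hh]
  · intro i hi c hc
    rcases Finset.mem_union.mp hc with hc | hc
    · exact hi c (Finset.mem_filter.mp hc).1
    · obtain ⟨g, hg, h, hh, rfl⟩ := Finset.mem_image₂.mp hc
      simp [n, hi g (Finset.mem_filter.mp hg).1, hi h (Finset.mem_filter.mp hh).1]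
  · intro x y hxy
    obtain ⟨t, ht⟩ := exists_sign_sub_eq G₁ (fun g => x j - linFunctional (n g) x)
      (fun g => y j - linFunctional (n g) y) (y j) (fun g hg h hh => by
        have := hxy (n h - n g) (by
          exact_mod_cast Finset.mem_union_right _ (Finset.mem_image₂_of_mem hh hg))
        simpa only [linFunctional_sub, sub_sub_sub_cancel_left] using this)
    refine ⟨x + Finsupp.single j (t - x j), fun i hi => by simp [hi], fun g hg => ?_⟩
    have hg' : g ∈ G := by exact_mod_cast hg
    by_cases hgj : g j = 0
    · have := hxy g (by
        exact_mod_cast Finset.mem_union_left _ (Finset.mem_filter.mpr ⟨hg', hgj⟩))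
      rwa [linFunctional_apply_add, linFunctional_apply_single, hgj, zero_mul, add_zero]
    · have hg₁ : g ∈ G₁ := Finset.mem_filter.mpr ⟨hg', hgj⟩
      have hgn : g = g j • n g := by simp [n, smul_smul, mul_inv_cancel₀ hgj]
      have key : SignType.sign (linFunctional (n g) (x + Finsupp.single j (t - x j))) =
          SignType.sign (linFunctional (n g) y) := by
        have := ht g hg₁
        rw [sub_sub_cancel] at this
        rw [← this, linFunctional_apply_add, linFunctional_apply_single, hn g hg₁, one_mul]
        congr 1
        abel
      have hsign : ∀ w, SignType.sign (linFunctional g w) =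
          SignType.sign (g j) * SignType.sign (linFunctional (n g) w) := fun w => by
        rw [← sign_mul, ← linFunctional_smul, ← hgn]
      rw [hsign, hsign, key]

/-- Elimination of finitely many coordinates. -/
theorem exists_eliminate_coordinates (S : Finset J) (G : Finset (J →₀ 𝕜)) :
    ∃ C : Finset (J →₀ 𝕜), (∀ j ∈ S, ∀ c ∈ C, c j = 0) ∧
      (∀ i, (∀ g ∈ G, g i = 0) → ∀ c ∈ C, c i = 0) ∧
      ∀ x y, SignEquiv (C : Set (J →₀ 𝕜)) x y →
        ∃ x' : J →₀ 𝕜, (∀ i, i ∉ S → x' i = x i) ∧ SignEquiv (G : Set (J →₀ 𝕜)) x' y := by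
  classical
  induction S using Finset.induction_on generalizing G with
  | empty => exact ⟨G, by simp, fun i hi => hi, fun x y h => ⟨x, fun _ _ => rfl, h⟩⟩
  | insert j S _ ih =>
    obtain ⟨C₁, hj, hsupp₁, hC₁⟩ := exists_eliminate_coordinate G j
    obtain ⟨C, hS, hsupp, hC⟩ := ih C₁
    refine ⟨C, ?_, fun i hi => hsupp i (hsupp₁ i hi), fun x y hxy => ?_⟩
    · intro i hi
      rcases Finset.mem_insert.mp hi with rfl | hi
      -- Later eliminations cannot reintroduce a coordinate already removed.
      · exact hsupp i hj
      · exact hS i hi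
    · obtain ⟨x₁, hx₁, h₁⟩ := hC x y hxy
      obtain ⟨x₂, hx₂, h₂⟩ := hC₁ x₁ y h₁
      refine ⟨x₂, fun i hi => ?_, h₂⟩
      rw [Finset.mem_insert, not_or] at hi
      rw [hx₂ i hi.1, hx₁ i hi.2]

/-- Fourier–Motzkin elimination: the signs that a functional `e` takes on the classes modulo
`𝕜^(I) ∪ D` are governed by finitely many functionals of `𝕜^(I) ∪ D`. -/
theorem exists_finset_signEquiv (I : Set J) {D : Set (J →₀ 𝕜)} (hD : D.Finite) (e : J →₀ 𝕜) :
    ∃ F₀ : Finset (J →₀ 𝕜), (F₀ : Set (J →₀ 𝕜)) ⊆ kkp 𝕜 I ∪ D ∧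
      ∀ x y, SignEquiv (F₀ : Set (J →₀ 𝕜)) x y → ∃ x', SignEquiv (kkp 𝕜 I ∪ D) x' x ∧
        SignType.sign (linFunctional e x') = SignType.sign (linFunctional e y) := by
  classical
  let G : Finset (J →₀ 𝕜) := insert e hD.toFinset
  obtain ⟨C, hS, hsupp, hC⟩ :=
    exists_eliminate_coordinates ((G.biUnion Finsupp.support).filter fun j => j ∉ I) G
  -- Only coordinates outside I are eliminated, so C lies in 𝕜^(I) and x' agrees with x on I. Adding
  -- D lets signs on D pass from y, which x' follows, back to x.
  refine ⟨C ∪ hD.toFinset, ?_, fun x y hxy => ?_⟩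
  · intro c hc
    rcases Finset.mem_union.mp (Finset.mem_coe.mp hc) with hc | hc
    · refine Or.inl fun j hj => ?_
      by_contra hjI
      refine Finsupp.mem_support_iff.mp hj ?_
      by_cases hjG : j ∈ G.biUnion Finsupp.support
      · exact hS j (Finset.mem_filter.mpr ⟨hjG, hjI⟩) c hc
      · refine hsupp j (fun g hg => ?_) c hc
        by_contra hgj
        exact hjG (Finset.mem_biUnion.mpr ⟨g, hg, Finsupp.mem_support_iff.mpr hgj⟩)
    · exact Or.inr (hD.mem_toFinset.mp hc)
  · obtain ⟨x', hx', hG⟩ := hC x y (hxy.mono (by simp))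
    refine ⟨x', ?_, hG e (by simp [G])⟩
    rintro d (hd | hd)
    · rw [linFunctional_congr (x := x') (y := x)]
      intro j hj
      refine hx' j fun hjS => (Finset.mem_filter.mp hjS).2 ?_
      exact hd (Finset.mem_coe.mpr (Finsupp.mem_support_iff.mpr hj))
    · exact (hG d (by simp [G, hd])).trans (hxy d (by simp [hd])).symm

/-- A small perturbation does not change nonzero signs. -/
theorem exists_pos_sign_add_mul {ι : Type*} (A : Finset ι) (p q : ι → 𝕜) :
    ∃ ε > 0, ∀ δ, 0 < δ → δ < ε → ∀ i ∈ A, p i ≠ 0 →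
      SignType.sign (p i + q i * δ) = SignType.sign (p i) := by
  classical
  induction A using Finset.induction_on with
  | empty => exact ⟨1, one_pos, by simp⟩
  | insert k A _ ih =>
    obtain ⟨ε, hε, h⟩ := ih
    by_cases hk : p k = 0 ∨ q k = 0
    · refine ⟨ε, hε, fun δ h0 hδ i hi hpi => ?_⟩
      rcases Finset.mem_insert.mp hi with rfl | hi
      · simp [hk.resolve_left hpi]
      · exact h δ h0 hδ i hi hpi
    · push Not at hk
      refine ⟨min ε (|q k|⁻¹ * |p k|), lt_min hε
        (mul_pos (inv_pos.mpr (abs_pos.mpr hk.2)) (abs_pos.mpr hk.1)), fun δ h0 hδ i hi hpi => ?_⟩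
      rcases Finset.mem_insert.mp hi with rfl | hi
      · have hlt : |q i * δ| < |p i| := by
          rw [abs_mul, abs_of_pos h0]
          calc |q i| * δ < |q i| * (|q i|⁻¹ * |p i|) :=
                mul_lt_mul_of_pos_left (hδ.trans_le (min_le_right _ _)) (abs_pos.mpr hk.2)
            _ = |p i| := mul_inv_cancel_left₀ (abs_pos.mpr hk.2).ne' _
        obtain ⟨hl, hr⟩ := abs_lt.mp hlt
        rcases lt_or_gt_of_ne hpi with hp | hp
        · rw [abs_of_neg hp] at hr
          rw [sign_neg hp, sign_neg (lt_neg_iff_add_neg'.mp hr)]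
        · rw [abs_of_pos hp] at hl
          rw [sign_pos hp, sign_pos (neg_lt_iff_pos_add'.mp hl)]
      · exact h δ h0 (hδ.trans_le (min_le_left _ _)) i hi hpi

/-- If a class of sign equivalence contains no zero of `e`, then `e` has constant sign on it. -/
theorem SignEquiv.exists_eq_zero {F : Set (J →₀ 𝕜)} {e x y : J →₀ 𝕜} (h : SignEquiv F x y)
    (hx : linFunctional e x < 0) (hy : 0 < linFunctional e y) :
    ∃ z, SignEquiv F z x ∧ linFunctional e z = 0 := by
  have hs : 0 < (-linFunctional e x)⁻¹ := inv_pos.mpr (neg_pos.mpr hx)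
  have ht : 0 < (linFunctional e y)⁻¹ := inv_pos.mpr hy
  -- Positive right scaling makes the values of e equal to -1 and 1, so they cancel; a positive
  -- combination preserves common signs.
  refine ⟨MulOpposite.op (-linFunctional e x)⁻¹ • x + MulOpposite.op (linFunctional e y)⁻¹ • y,
    fun d hd => ?_, ?_⟩
  · rw [linFunctional_apply_add, linFunctional_apply_op_smul, linFunctional_apply_op_smul]
    have hd := h d hd
    rcases lt_trichotomy (linFunctional d x) 0 with h0 | h0 | h0
    · rw [sign_neg h0, eq_comm, sign_eq_neg_one_iff] at hd
      rw [sign_neg h0, sign_neg (add_neg (mul_neg_of_neg_of_pos h0 hs)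
        (mul_neg_of_neg_of_pos hd ht))]
    · rw [h0, sign_zero, eq_comm, sign_eq_zero_iff] at hd
      simp [h0, hd]
    · rw [sign_pos h0, eq_comm, sign_eq_one_iff] at hd
      rw [sign_pos h0, sign_pos (add_pos (mul_pos h0 hs) (mul_pos hd ht))]
  · rw [linFunctional_apply_add, linFunctional_apply_op_smul, linFunctional_apply_op_smul,
      inv_neg, mul_neg, mul_inv_cancel₀ hx.ne, mul_inv_cancel₀ hy.ne', neg_add_cancel]

end SignEquiv

/-! ### Separation and extension in distributive lattices. -/

section Distrib

/-- The product of two elements in normal form over `a` and `b`, where `a` and `b` are disjoint. -/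
theorem sup_inf_sup_normalForm {M : Type*} [DistribLattice M] [OrderBot M] {a b : M}
    (hab : a ⊓ b = ⊥) (x y z x' y' z' : M) :
    (x ⊔ y ⊓ a ⊔ z ⊓ b) ⊓ (x' ⊔ y' ⊓ a ⊔ z' ⊓ b) =
      x ⊓ x' ⊔ (x ⊓ y' ⊔ y ⊓ x' ⊔ y ⊓ y') ⊓ a ⊔ (x ⊓ z' ⊔ z ⊓ x' ⊔ z ⊓ z') ⊓ b := by
  have h₁ : y ⊓ a ⊓ (z' ⊓ b) = ⊥ := by rw [inf_inf_inf_comm, hab, inf_bot_eq]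
  have h₂ : z ⊓ b ⊓ (y' ⊓ a) = ⊥ := by rw [inf_inf_inf_comm, inf_comm b, hab, inf_bot_eq]
  have h₃ : y ⊓ a ⊓ (y' ⊓ a) = y ⊓ y' ⊓ a := by rw [inf_inf_inf_comm, inf_idem]
  have h₄ : z ⊓ b ⊓ (z' ⊓ b) = z ⊓ z' ⊓ b := by rw [inf_inf_inf_comm, inf_idem]
  simp only [inf_sup_left, inf_sup_right, h₁, h₂, h₃, h₄, sup_bot_eq]
  ac_rfl

/-- In a lattice where `x i` and `x' j` are always consonant, one can separate the differences
of the pairs `(x i, y i)` from those of the pairs `(x' j, y' j)`. -/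
theorem exists_disjoint_differences {M ι κ : Type*} [DistribLattice M] [BoundedOrder M]
    (S : Finset ι) (T : Finset κ) (x y : ι → M) (x' y' : κ → M)
    (hc : ∀ i ∈ S, ∀ j ∈ T, ∃ u v, x i ≤ u ⊔ x' j ∧ x' j ≤ x i ⊔ v ∧ u ⊓ v = ⊥)
    (h : ∀ i ∈ S, ∀ j ∈ T, x i ⊓ x' j ≤ y i ⊓ y' j) :
    ∃ a b : M, a ⊓ b = ⊥ ∧ a ≤ S.sup x ∧ b ≤ T.sup x' ∧
      (∀ i ∈ S, x i ≤ a ⊔ y i) ∧ ∀ j ∈ T, x' j ≤ b ⊔ y' j := by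
  classical
  choose! u v hu hv huv using hc
  -- Each term of the first join lies below every u i j and each term of the second below every v i
  -- j, whence disjointness. The error x i ⊓ x' j left by consonance is absorbed by `h`.
  refine ⟨S.sup fun i => x i ⊓ T.inf (u i), T.sup fun j => x' j ⊓ S.inf fun i => v i j,
    ?_, ?_, ?_, ?_, ?_⟩
  · rw [← disjoint_iff, Finset.disjoint_sup_left]
    intro i hi
    rw [Finset.disjoint_sup_right]
    intro j hj
    refine (disjoint_iff.mpr (huv i hi j hj)).mono (inf_le_right.trans (Finset.inf_le hj))
      (inf_le_right.trans ?_)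
    exact Finset.inf_le (f := fun i => v i j) hi
  · exact Finset.sup_mono_fun fun i _ => inf_le_left
  · exact Finset.sup_mono_fun fun i _ => inf_le_left
  · intro i hi
    have hle : x i ≤ (T.inf (u i)) ⊔ y i := by
      rw [Finset.inf_sup_distrib_right]
      refine Finset.le_inf fun j hj => ?_
      calc x i ≤ x i ⊓ (u i j ⊔ x' j) := le_inf le_rfl (hu i hi j hj)
        _ = x i ⊓ u i j ⊔ x i ⊓ x' j := inf_sup_left _ _ _
        _ ≤ u i j ⊔ y i := sup_le_sup inf_le_right ((h i hi j hj).trans inf_le_left)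
    calc x i ≤ x i ⊓ ((T.inf (u i)) ⊔ y i) := le_inf le_rfl hle
      _ = x i ⊓ T.inf (u i) ⊔ x i ⊓ y i := inf_sup_left _ _ _
      _ ≤ _ := sup_le_sup (Finset.le_sup (f := fun i => x i ⊓ T.inf (u i)) hi) inf_le_right
  · intro j hj
    have hle : x' j ≤ (S.inf fun i => v i j) ⊔ y' j := by
      rw [Finset.inf_sup_distrib_right]
      refine Finset.le_inf fun i hi => ?_
      calc x' j ≤ x' j ⊓ (x i ⊔ v i j) := le_inf le_rfl (hv i hi j hj)
        _ = x i ⊓ x' j ⊔ x' j ⊓ v i j := by rw [inf_sup_left, inf_comm (x i)]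
        _ ≤ v i j ⊔ y' j := sup_le ((h i hi j hj).trans (inf_le_right.trans le_sup_right))
            (inf_le_right.trans le_sup_left)
    calc x' j ≤ x' j ⊓ ((S.inf fun i => v i j) ⊔ y' j) := le_inf le_rfl hle
      _ = x' j ⊓ (S.inf fun i => v i j) ⊔ x' j ⊓ y' j := inf_sup_left _ _ _
      _ ≤ _ := sup_le_sup (Finset.le_sup (f := fun j => x' j ⊓ S.inf fun i => v i j) hj)
            inf_le_right

/-- If `X` is covered by `Y` and finitely many differences `A i \ B i`, all in a sublattice `K`
of a powerset, then a bound for these differences under a lattice homomorphism yields a bound for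
the difference of `X` and `Y`. -/
theorem LatticeHom.le_sup_of_subset_cover {V M ι : Type*} [DistribLattice M]
    {K : Sublattice (Set V)} (f : LatticeHom K M) (S : Finset ι) (A B : ι → K) (c : M)
    (hc : ∀ i ∈ S, f (A i) ≤ c ⊔ f (B i)) (X Y : K)
    (h : ∀ p ∈ (X : Set V), p ∉ (Y : Set V) → ∃ i ∈ S, p ∈ (A i : Set V) ∧ p ∉ (B i : Set V)) :
    f X ≤ f Y ⊔ c := by
  classical
  induction S using Finset.induction_on generalizing X Y with
  | empty =>
    refine (OrderHomClass.mono f (show X ≤ Y from fun p hp => ?_)).trans le_sup_left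
    by_contra hpY
    simpa using h p hp hpY
  | insert k S _ ih =>
    have ih' := ih fun i hi => hc i (Finset.mem_insert_of_mem hi)
    -- The k-th difference becomes superfluous after shrinking X to X ⊓ B k or enlarging Y to Y ⊔ A
    -- k; distributivity combines the two bounds.
    have h₁ : f (X ⊓ B k) ≤ f Y ⊔ c := by
      refine ih' _ _ fun p hp hpY => ?_
      obtain ⟨i, hi, hiA, hiB⟩ := h p hp.1 hpY
      rcases Finset.mem_insert.mp hi with rfl | hi
      · exact absurd hp.2 hiB
      · exact ⟨i, hi, hiA, hiB⟩
    have h₂ : f X ≤ f (Y ⊔ A k) ⊔ c := by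
      refine ih' _ _ fun p hp hpY => ?_
      obtain ⟨i, hi, hiA, hiB⟩ := h p hp fun hpY' => hpY (Or.inl hpY')
      rcases Finset.mem_insert.mp hi with rfl | hi
      · exact absurd (Or.inr hiA) hpY
      · exact ⟨i, hi, hiA, hiB⟩
    rw [map_inf] at h₁
    rw [map_sup] at h₂
    have h₃ : f X ≤ f (B k) ⊔ (f Y ⊔ c) := by
      refine h₂.trans (sup_le (sup_le ?_ ?_) ?_)
      · exact le_sup_left.trans le_sup_right
      · refine (hc k (Finset.mem_insert_self _ _)).trans (sup_le ?_ le_sup_left)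
        exact le_sup_right.trans le_sup_right
      · exact le_sup_right.trans le_sup_right
    calc f X ≤ f X ⊓ (f (B k) ⊔ (f Y ⊔ c)) := le_inf le_rfl h₃
      _ = f X ⊓ f (B k) ⊔ f X ⊓ (f Y ⊔ c) := inf_sup_left _ _ _
      _ ≤ f Y ⊔ c := sup_le h₁ inf_le_right

/-- Extension of a homomorphism from a sublattice of a powerset to the sublattice generated by two
more disjoint sets. -/
theorem LatticeHom.exists_extension {V M : Type*} [DistribLattice M] [BoundedOrder M]
    {K K' : Sublattice (Set V)} [BoundedOrder K] (hbot : ((⊥ : K) : Set V) = ∅)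
    (f : LatticeHom K M) (hf : f ⊥ = ⊥) (hK : K ≤ K') (P N : Set V) (hPN : P ∩ N = ∅)
    (hK' : ∀ U ∈ K', ∃ X Y Z : K, U = (X : Set V) ∪ Y ∩ P ∪ Z ∩ N) (a b : M) (hab : a ⊓ b = ⊥)
    (ha : ∀ X Y : K, (X : Set V) ⊆ Y ∪ P → f X ≤ f Y ⊔ a)
    (hb : ∀ X Y : K, (X : Set V) ⊆ Y ∪ N → f X ≤ f Y ⊔ b)
    (hab' : ∀ X Y : K, (X : Set V) ⊆ Y ∪ (P ∪ N) → f X ≤ f Y ⊔ (a ⊔ b))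
    (ha' : ∀ X Y : K, (X : Set V) ∩ P ⊆ Y → f X ⊓ a ≤ f Y)
    (hb' : ∀ X Y : K, (X : Set V) ∩ N ⊆ Y → f X ⊓ b ≤ f Y) :
    ∃ g : LatticeHom K' M, (∀ X : K, g (Sublattice.inclusion hK X) = f X) ∧
      ∀ U : K', ∃ X Y Z : K, (U : Set V) = (X : Set V) ∪ Y ∩ P ∪ Z ∩ N ∧
        g U = f X ⊔ f Y ⊓ a ⊔ f Z ⊓ b := by
  have hPN' : ∀ p ∈ P, p ∉ N := fun p hp hn => (hPN ▸ (⟨hp, hn⟩ : p ∈ P ∩ N) : p ∈ (∅ : Set V))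
  -- This makes the value of g independent of the chosen normal form.
  have mono : ∀ X Y Z X' Y' Z' : K, (X : Set V) ∪ Y ∩ P ∪ Z ∩ N ⊆ (X' : Set V) ∪ Y' ∩ P ∪ Z' ∩ N →
      f X ⊔ f Y ⊓ a ⊔ f Z ⊓ b ≤ f X' ⊔ f Y' ⊓ a ⊔ f Z' ⊓ b := by
    intro X Y Z X' Y' Z' h
    refine sup_le (sup_le ?_ ?_) ?_
    · have hX : (X : Set V) ⊆ X' ∪ Y' ∩ P ∪ Z' ∩ N := fun p hp => h (Or.inl (Or.inl hp))
      -- As a meet of four joins, the right side asks for one bound each with no new value, with a,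
      -- with b, and with a ⊔ b.
      rw [sup_inf_left, sup_inf_left, sup_inf_right, sup_inf_right]
      refine le_inf (le_inf ?_ ?_) (le_inf ?_ ?_)
      · rw [← map_sup, ← map_sup]
        refine OrderHomClass.mono f fun p hp => ?_
        rcases hX hp with (h | h) | h
        exacts [Or.inl (Or.inl h), Or.inl (Or.inr h.1), Or.inr h.1]
      · rw [sup_right_comm, ← map_sup]
        refine ha X (X' ⊔ Z') fun p hp => ?_
        rcases hX hp with (h | h) | h
        exacts [Or.inl (Or.inl h), Or.inr h.2, Or.inl (Or.inr h.1)]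
      · rw [← map_sup]
        refine hb X (X' ⊔ Y') fun p hp => ?_
        rcases hX hp with (h | h) | h
        exacts [Or.inl (Or.inl h), Or.inl (Or.inr h.1), Or.inr h.2]
      · rw [sup_assoc]
        refine hab' X X' fun p hp => ?_
        rcases hX hp with (h | h) | h
        exacts [Or.inl h, Or.inr (Or.inl h.2), Or.inr (Or.inr h.2)]
    · refine le_trans ?_ le_sup_left
      have := ha' Y (X' ⊔ Y') fun p hp => by
        rcases h (Or.inl (Or.inr hp)) with (h | h) | h
        exacts [Or.inl h, Or.inr h.1, absurd h.2 (hPN' p hp.2)]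
      rw [map_sup] at this
      rw [sup_inf_left]
      exact le_inf this (inf_le_right.trans le_sup_right)
    · rw [sup_right_comm]
      refine le_trans ?_ le_sup_left
      have := hb' Z (X' ⊔ Z') fun p hp => by
        rcases h (Or.inr hp) with (h | h) | h
        exacts [Or.inl h, absurd hp.2 (hPN' p h.2), Or.inr h.1]
      rw [map_sup] at this
      rw [sup_inf_left]
      exact le_inf this (inf_le_right.trans le_sup_right)
  choose! X Y Z hXYZ using hK'
  let g : Set V → M := fun U => f (X U) ⊔ f (Y U) ⊓ a ⊔ f (Z U) ⊓ b
  have hg : ∀ U ∈ K', ∀ A B C : K, U = (A : Set V) ∪ B ∩ P ∪ C ∩ N →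
      g U = f A ⊔ f B ⊓ a ⊔ f C ⊓ b := fun U hU A B C hABC =>
    le_antisymm (mono _ _ _ _ _ _ (by rw [← hXYZ U hU, ← hABC]))
      (mono _ _ _ _ _ _ (by rw [← hXYZ U hU, ← hABC]))
  refine ⟨⟨⟨fun U => g U, fun U W => ?_⟩, fun U W => ?_⟩, fun A => ?_,
    fun U => ⟨X U, Y U, Z U, hXYZ U U.2, rfl⟩⟩
  · rw [hg _ (U ⊔ W).2 (X U ⊔ X W) (Y U ⊔ Y W) (Z U ⊔ Z W)]
    · simp only [g, map_sup, inf_sup_right]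
      ac_rfl
    · change (U : Set V) ⊔ W = (X U ⊔ X W : Set V) ⊔ (Y U ⊔ Y W) ⊓ P ⊔ (Z U ⊔ Z W) ⊓ N
      conv_lhs => rw [hXYZ U U.2, hXYZ W W.2]
      simp only [inf_sup_right, ← Set.sup_eq_union, ← Set.inf_eq_inter]
      ac_rfl
  · have hd := sup_inf_sup_normalForm hab (f (X U)) (f (Y U)) (f (Z U)) (f (X W)) (f (Y W))
      (f (Z W))
    have hs := sup_inf_sup_normalForm (M := Set V) hPN (X U) (Y U) (Z U) (X W) (Y W) (Z W)
    simp only [← map_inf, ← map_sup] at hd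
    refine Eq.trans (hg _ (U ⊓ W).2 _ _ _ ?_) hd.symm
    refine Eq.trans ?_ hs
    exact congrArg₂ (· ∩ ·) (hXYZ U U.2) (hXYZ W W.2)
  · refine (hg _ (Sublattice.inclusion hK A).2 A ⊥ ⊥ ?_).trans ?_
    · simp [hbot]
    · simp [hf]

end Distrib

/-! ### Cells and open stars of a finite arrangement. -/

section Cells

variable {𝕜 J : Type*} [DivisionRing 𝕜] [LinearOrder 𝕜]

theorem pos_mem_OpK {I : Set J} {D : Set (J →₀ 𝕜)} {d : J →₀ 𝕜} (hd : d ∈ kkp 𝕜 I ∪ D) :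
    {x | 0 < linFunctional d x} ∈ OpK I D :=
  Or.inl (subset_latticeClosure ⟨_, ⟨d, hd, rfl⟩, Or.inl rfl⟩)

theorem neg_mem_OpK {I : Set J} {D : Set (J →₀ 𝕜)} {d : J →₀ 𝕜} (hd : d ∈ kkp 𝕜 I ∪ D) :
    {x | linFunctional d x < 0} ∈ OpK I D :=
  Or.inl (subset_latticeClosure ⟨_, ⟨d, hd, rfl⟩, Or.inr rfl⟩)

/-- A sublattice containing `univ` and the sign sets of all functionals contains `OpK I D`. -/
theorem OpK_le {I : Set J} {D : Set (J →₀ 𝕜)} {K : Sublattice (Set (J →₀ 𝕜))}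
    (huniv : Set.univ ∈ K) (hpos : ∀ d ∈ kkp 𝕜 I ∪ D, {x | 0 < linFunctional d x} ∈ K)
    (hneg : ∀ d ∈ kkp 𝕜 I ∪ D, {x | linFunctional d x < 0} ∈ K) : OpK I D ≤ K := by
  rintro X (hX | hX)
  · refine latticeClosure_min ?_ K.isSublattice hX
    rintro _ ⟨_, ⟨d, hd, rfl⟩, rfl | rfl⟩
    exacts [hpos d hd, hneg d hd]
  · rwa [Set.mem_singleton_iff.mp hX]

/-- The sets that do not separate x from y form a sublattice containing the generators. -/
theorem SignEquiv.mem_iff {I : Set J} {D : Set (J →₀ 𝕜)} {x y : J →₀ 𝕜}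
    (h : SignEquiv (kkp 𝕜 I ∪ D) x y) (X : OpK I D) :
    x ∈ (X : Set (J →₀ 𝕜)) ↔ y ∈ (X : Set (J →₀ 𝕜)) := by
  let K : Sublattice (Set (J →₀ 𝕜)) :=
    { carrier := {X | x ∈ X ↔ y ∈ X}
      supClosed' := fun X hX Y hY => or_congr hX hY
      infClosed' := fun X hX Y hY => and_congr hX hY }
  have hK : OpK I D ≤ K := OpK_le (Iff.intro (fun _ => trivial) fun _ => trivial)
    (fun d hd => show 0 < linFunctional d x ↔ 0 < linFunctional d y by
      rw [← sign_eq_one_iff, ← sign_eq_one_iff, h d hd])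
    (fun d hd => show linFunctional d x < 0 ↔ linFunctional d y < 0 by
      rw [← sign_eq_neg_one_iff, ← sign_eq_neg_one_iff, h d hd])
  exact hK X.2

/-- The open star of the cell of a vector `z` in the arrangement of hyperplanes given by `F`,
where `σ` is the sign vector of `z`. -/
def openStar (F : Finset (J →₀ 𝕜)) (σ : F → SignType) : Set (J →₀ 𝕜) :=
  {x | ∀ d : F, σ d ≠ 0 → SignType.sign (linFunctional d.1 x) = σ d}

/-- The points of the open star of a cell that do not belong to the cell. -/
def openStarBoundary (F : Finset (J →₀ 𝕜)) (σ : F → SignType) : Set (J →₀ 𝕜) :=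
  openStar F σ ∩ {x | ∃ d : F, σ d = 0 ∧ linFunctional d.1 x ≠ 0}

/-- The sign vector of `x` with respect to `F`. -/
def signVector (F : Finset (J →₀ 𝕜)) (x : J →₀ 𝕜) : F → SignType :=
  fun d => SignType.sign (linFunctional d.1 x)

/-- Zero signs impose no condition, so only strict inequalities are intersected; an empty
intersection is the adjoined top. -/
theorem openStar_mem_OpK {I : Set J} {D : Set (J →₀ 𝕜)} {F : Finset (J →₀ 𝕜)}
    (hF : (F : Set (J →₀ 𝕜)) ⊆ kkp 𝕜 I ∪ D) (σ : F → SignType) : openStar F σ ∈ OpK I D := by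
  have h : openStar F σ = Finset.univ.inf fun d : F =>
      {x | σ d ≠ 0 → SignType.sign (linFunctional d.1 x) = σ d} := by
    ext x
    simp [openStar, Finset.inf_set_eq_iInter]
  rw [h]
  refine Finset.inf_induction (p := (· ∈ OpK I D)) (univ_mem_Op _)
    (fun _ hX _ hY => (OpK I D).infClosed hX hY) fun d _ => ?_
  rcases hσ : σ d with _ | _ | _
  · refine (congrArg (· ∈ OpK I D) ?_).mpr (univ_mem_Op _)
    ext x
    simp
  · refine (congrArg (· ∈ OpK I D) ?_).mpr (neg_mem_OpK (hF d.2))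
    ext x
    simp [sign_eq_neg_one_iff]
  · refine (congrArg (· ∈ OpK I D) ?_).mpr (pos_mem_OpK (hF d.2))
    ext x
    simp [sign_eq_one_iff]

theorem openStarBoundary_mem_OpK {I : Set J} {D : Set (J →₀ 𝕜)} {F : Finset (J →₀ 𝕜)}
    (hF : (F : Set (J →₀ 𝕜)) ⊆ kkp 𝕜 I ∪ D) (σ : F → SignType) :
    openStarBoundary F σ ∈ OpK I D := by
  refine (OpK I D).infClosed (openStar_mem_OpK hF σ) ?_
  have h : {x : J →₀ 𝕜 | ∃ d : F, σ d = 0 ∧ linFunctional d.1 x ≠ 0} =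
      (Finset.univ.filter fun d => σ d = 0).sup fun d : F =>
        {x | 0 < linFunctional d.1 x} ⊔ {x | linFunctional d.1 x < 0} := by
    ext x
    simp [Finset.sup_set_eq_biUnion, or_comm]
  rw [h]
  exact Finset.sup_induction (p := (· ∈ OpK I D)) (empty_mem_OpK I D)
    (fun _ hX _ hY => (OpK I D).supClosed hX hY) fun d _ =>
    (OpK I D).supClosed (pos_mem_OpK (hF d.2)) (neg_mem_OpK (hF d.2))

theorem mem_openStar_signVector (F : Finset (J →₀ 𝕜)) (x : J →₀ 𝕜) :
    x ∈ openStar F (signVector F x) := fun _ _ => rfl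

theorem notMem_openStarBoundary_signVector (F : Finset (J →₀ 𝕜)) (x : J →₀ 𝕜) :
    x ∉ openStarBoundary F (signVector F x) := by
  rintro ⟨-, d, hd, hd'⟩
  exact hd' (sign_eq_zero_iff.mp hd)

/-- A point of an open star outside its boundary belongs to the cell. -/
theorem signEquiv_of_mem_openStar {F : Finset (J →₀ 𝕜)} {x z : J →₀ 𝕜}
    (hx : x ∈ openStar F (signVector F z)) (hx' : x ∉ openStarBoundary F (signVector F z)) :
    SignEquiv (F : Set (J →₀ 𝕜)) x z := by
  intro d hd
  by_cases h0 : signVector F z ⟨d, hd⟩ = 0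
  · have : linFunctional d x = 0 := by
      by_contra hne
      exact hx' ⟨hx, ⟨d, hd⟩, h0, hne⟩
    rw [this, sign_zero]
    exact h0.symm
  · exact hx ⟨d, hd⟩ h0

/-- Every point in the open star of the cell of `z` has a sign equivalent point on which `e` has the
same sign as on `z`, if this sign is nonzero. -/
theorem exists_signEquiv_of_mem_openStar [IsStrictOrderedRing 𝕜] {F : Finset (J →₀ 𝕜)}
    {e x z : J →₀ 𝕜} (hx : x ∈ openStar F (signVector F z)) (hz : linFunctional e z ≠ 0) :
    ∃ y, SignEquiv (F : Set (J →₀ 𝕜)) x y ∧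
      SignType.sign (linFunctional e y) = SignType.sign (linFunctional e z) := by
  classical
  obtain ⟨ε, hε, h⟩ := exists_pos_sign_add_mul (insert e F) (fun d => linFunctional d z)
    (fun d => linFunctional d x)
  have := DivisionRing.denselyOrdered 𝕜
  obtain ⟨δ, h0, hδ⟩ := exists_between hε
  have hadd : ∀ d, linFunctional d (z + MulOpposite.op δ • x) =
      linFunctional d z + linFunctional d x * δ := fun d => by
    rw [linFunctional_apply_add, linFunctional_apply_op_smul]
  -- A small move from z towards x keeps the nonzero signs at z, which x shares on F, and gives
  -- functionals vanishing at z the sign they have at x.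
  refine ⟨z + MulOpposite.op δ • x, fun d hd => ?_, ?_⟩
  · rw [hadd]
    by_cases hdz : linFunctional d z = 0
    · rw [hdz, zero_add, sign_mul, sign_pos h0, mul_one]
    · rw [h δ h0 hδ d (Finset.mem_insert_of_mem hd) hdz]
      exact hx ⟨d, hd⟩ (sign_eq_zero_iff.not.mpr hdz)
  · rw [hadd]
    exact h δ h0 hδ e (Finset.mem_insert_self _ _) hz

end Cells

/-! ### Adjoining one functional. -/

/-- Normal form of the elements of `OpK I (D ∪ {e})` over `OpK I D`. -/
theorem exists_normalForm_OpK {𝕜 J : Type*} [DivisionRing 𝕜] [LinearOrder 𝕜] (I : Set J)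
    (D : Set (J →₀ 𝕜)) (e : J →₀ 𝕜) (U : Set (J →₀ 𝕜)) (hU : U ∈ OpK I (D ∪ {e})) :
    ∃ X Y Z : OpK I D, U = (X : Set (J →₀ 𝕜)) ∪ Y ∩ {x | 0 < linFunctional e x} ∪
      Z ∩ {x | linFunctional e x < 0} := by
  have hPN : {x | 0 < linFunctional e x} ⊓ {x | linFunctional e x < 0} = ⊥ := by
    ext x
    simpa using fun h : 0 < linFunctional e x => h.le
  let K : Sublattice (Set (J →₀ 𝕜)) :=
    { carrier := {U | ∃ X Y Z : OpK I D, U = (X : Set (J →₀ 𝕜)) ∪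
        Y ∩ {x | 0 < linFunctional e x} ∪ Z ∩ {x | linFunctional e x < 0}}
      supClosed' := by
        rintro _ ⟨X, Y, Z, rfl⟩ _ ⟨X', Y', Z', rfl⟩
        refine ⟨X ⊔ X', Y ⊔ Y', Z ⊔ Z', ?_⟩
        simp only [Sublattice.coe_sup, ← Set.sup_eq_union, ← Set.inf_eq_inter, inf_sup_right]
        ac_rfl
      infClosed' := by
        rintro _ ⟨X, Y, Z, rfl⟩ _ ⟨X', Y', Z', rfl⟩
        exact ⟨X ⊓ X', X ⊓ Y' ⊔ Y ⊓ X' ⊔ Y ⊓ Y', X ⊓ Z' ⊔ Z ⊓ X' ⊔ Z ⊓ Z',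
          sup_inf_sup_normalForm hPN (X : Set (J →₀ 𝕜)) Y Z X' Y' Z'⟩ }
  have hsub : ∀ X ∈ OpK I D, X ∈ K := fun X hX => ⟨⟨X, hX⟩, ⊥, ⊥, by
    change X = X ∪ ∅ ∩ _ ∪ ∅ ∩ _
    simp⟩
  refine OpK_le (K := K) (hsub _ (univ_mem_Op _)) ?_ ?_ hU
  · rintro d (hd | hd | rfl)
    · exact hsub _ (pos_mem_OpK (Or.inl hd))
    · exact hsub _ (pos_mem_OpK (Or.inr hd))
    · refine ⟨⊥, ⊤, ⊥, ?_⟩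
      change _ = ∅ ∪ Set.univ ∩ _ ∪ ∅ ∩ _
      simp
  · rintro d (hd | hd | rfl)
    · exact hsub _ (neg_mem_OpK (Or.inl hd))
    · exact hsub _ (neg_mem_OpK (Or.inr hd))
    · refine ⟨⊥, ⊥, ⊤, ?_⟩
      change _ = ∅ ∪ ∅ ∩ _ ∪ Set.univ ∩ _
      simp

theorem CompletelyNormal.exists_withTop {L : Type*} [DistribLattice L] [OrderBot L]
    (hL : CompletelyNormal L) {x y : WithTop L} (hx : x ≠ ⊤) (hy : y ≠ ⊤) :
    ∃ u v : WithTop L, x ≤ u ⊔ y ∧ y ≤ x ⊔ v ∧ u ⊓ v = ⊥ := by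
  lift x to L using hx
  lift y to L using hy
  obtain ⟨u, v, h₁, h₂, h₃⟩ := hL x y
  exact ⟨u, v, by exact_mod_cast h₁, by exact_mod_cast h₂,
    by rw [← WithTop.coe_inf, h₃, WithTop.coe_bot]⟩

theorem WithTop.sup_ne_top {L : Type*} [SemilatticeSup L] {x y : WithTop L} (hx : x ≠ ⊤)
    (hy : y ≠ ⊤) : x ⊔ y ≠ ⊤ := by
  lift x to L using hx
  lift y to L using hy
  rw [← WithTop.coe_sup]
  exact WithTop.coe_ne_top

theorem WithTop.finset_sup_ne_top {L ι : Type*} [Lattice L] [OrderBot L] (S : Finset ι)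
    (x : ι → WithTop L) (hx : ∀ i ∈ S, x i ≠ ⊤) : S.sup x ≠ ⊤ :=
  Finset.sup_induction (p := (· ≠ ⊤)) WithTop.coe_ne_top (fun _ h _ h' => sup_ne_top h h') hx

theorem TopFaithful.eq_top_iff {P Q : Type*} [PartialOrder P] [OrderTop P] [PartialOrder Q]
    [OrderTop Q] {f : P → Q} (hf : TopFaithful f) {x : P} : f x = ⊤ ↔ x = ⊤ :=
  Set.ext_iff.mp hf x

theorem lemmaL {𝕜 J L : Type*} [DivisionRing 𝕜] [LinearOrder 𝕜] [IsStrictOrderedRing 𝕜]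
    [DistribLattice L] [OrderBot L] (hL : CompletelyNormal L)
    (I : Set J) (D : Set (J →₀ 𝕜)) (hD : D.Finite) (e : J →₀ 𝕜)
    (f : LatticeHom (OpK I D) (WithTop L)) (hf_zero : f ⊥ = ⊥) (hf_top : TopFaithful f) :
    ∃ g : LatticeHom (OpK I (D ∪ {e})) (WithTop L),
      TopFaithful g ∧
        ∀ X : OpK I D, g (Sublattice.inclusion (OpK_mono I Set.subset_union_left) X) = f X := by
  classical
  obtain ⟨F, hF, hFM⟩ := exists_finset_signEquiv I hD e
  -- the vectors on whose class `e` has constant sign `s`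
  let C : SignType → Set (J →₀ 𝕜) := fun s =>
    {x | ∀ y, SignEquiv (kkp 𝕜 I ∪ D) y x → SignType.sign (linFunctional e y) = s}
  let A : (F → SignType) → OpK I D := fun σ => ⟨openStar F σ, openStar_mem_OpK hF σ⟩
  let B : (F → SignType) → OpK I D :=
    fun σ => ⟨openStarBoundary F σ, openStarBoundary_mem_OpK hF σ⟩
  let S : SignType → Finset (F → SignType) := fun s => (Set.toFinite (signVector F '' C s)).toFinset
  have mem_S : ∀ {s σ}, σ ∈ S s ↔ ∃ z ∈ C s, signVector F z = σ := fun {s σ} => by simp [S]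
  -- the sign `s` is attained on every class meeting the star of a cell in `C s`
  have star : ∀ {s}, s ≠ 0 → ∀ {z}, z ∈ C s → ∀ {x}, x ∈ openStar F (signVector F z) →
      ∃ y, SignEquiv (kkp 𝕜 I ∪ D) y x ∧ SignType.sign (linFunctional e y) = s := by
    intro s hs z hz x hx
    have hez := hz z (SignEquiv.refl z)
    obtain ⟨y, hxy, hy⟩ := exists_signEquiv_of_mem_openStar (e := e) hx
      (sign_eq_zero_iff.not.mp (hez ▸ hs))
    obtain ⟨x', hx', he⟩ := hFM x y hxy
    exact ⟨x', hx', by rw [he, hy, hez]⟩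
  -- By elimination, constancy of the sign on the class of z spreads to the whole F-cell of z.
  have const : ∀ {s z x}, z ∈ C s → SignEquiv (F : Set (J →₀ 𝕜)) x z →
      SignType.sign (linFunctional e x) = s := by
    intro s z x hz hxz
    obtain ⟨x', hx', he⟩ := hFM z x hxz.symm
    rw [← he, hz x' hx']
  have A_ne_top : ∀ s, s ≠ 0 → ∀ σ ∈ S s, f (A σ) ≠ ⊤ := by
    intro s hs σ hσ hA
    obtain ⟨z, hz, rfl⟩ := mem_S.mp hσ
    rw [hf_top.eq_top_iff] at hA
    -- The origin lies on no boundary, so it would lie in the cell of z, where e has nonzero sign.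
    have h0 : (0 : J →₀ 𝕜) ∈ (A (signVector F z) : Set (J →₀ 𝕜)) := by
      rw [hA]
      exact Set.mem_univ _
    refine hs ((const hz (x := 0) ?_).symm.trans (by rw [linFunctional_apply_zero, sign_zero]))
    refine signEquiv_of_mem_openStar h0 ?_
    rintro ⟨-, d, -, hd⟩
    exact hd (linFunctional_apply_zero _)
  -- A common point of both stars lying in the cell of z would have an equivalent point where e has
  -- sign t, though e has sign s on that cell.
  have sep : ∀ {s t}, t ≠ 0 → s ≠ t → ∀ {z w}, z ∈ C s → w ∈ C t →
      ∀ x ∈ openStar F (signVector F z), x ∈ openStar F (signVector F w) →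
        x ∈ openStarBoundary F (signVector F z) := by
    intro s t ht hst z w hz hw x hxz hxw
    by_contra hx
    obtain ⟨y, hyx, hy⟩ := star ht hw hxw
    exact hst ((const hz ((hyx.mono hF).trans (signEquiv_of_mem_openStar hxz hx))).symm.trans hy)
  obtain ⟨a, b, hab, haA, hbA, ha, hb⟩ := exists_disjoint_differences (S 1) (S (-1))
    (fun σ => f (A σ)) (fun σ => f (B σ)) (fun σ => f (A σ)) (fun σ => f (B σ))
    (fun σ hσ τ hτ => hL.exists_withTop (A_ne_top 1 (by decide) σ hσ)
      (A_ne_top (-1) (by decide) τ hτ))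
    (fun σ hσ τ hτ => by
      obtain ⟨z, hz, rfl⟩ := mem_S.mp hσ
      obtain ⟨w, hw, rfl⟩ := mem_S.mp hτ
      rw [← map_inf, ← map_inf]
      refine OrderHomClass.mono f fun x hx => ⟨?_, ?_⟩
      · exact sep (by decide) (by decide) hz hw x hx.1 hx.2
      · exact sep (by decide) (by decide) hw hz x hx.2 hx.1)
  have a_ne : a ≠ ⊤ := ne_top_of_le_ne_top
    (WithTop.finset_sup_ne_top _ _ (A_ne_top 1 (by decide))) haA
  have b_ne : b ≠ ⊤ := ne_top_of_le_ne_top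
    (WithTop.finset_sup_ne_top _ _ (A_ne_top (-1) (by decide))) hbA
  -- classes on which `e` is constant are covered by the cells
  have cover : ∀ {s x}, x ∈ C s → ∃ σ ∈ S s, x ∈ (A σ : Set (J →₀ 𝕜)) ∧
      x ∉ (B σ : Set (J →₀ 𝕜)) := fun {s x} hx =>
    ⟨signVector F x, mem_S.mpr ⟨x, hx, rfl⟩, mem_openStar_signVector F x,
      notMem_openStarBoundary_signVector F x⟩
  have upper : ∀ s, s ≠ 0 → ∀ c ≤ (S s).sup fun σ => f (A σ), ∀ X Y : OpK I D,
      (∀ x ∈ (X : Set (J →₀ 𝕜)), SignType.sign (linFunctional e x) = s →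
        x ∈ (Y : Set (J →₀ 𝕜))) → f X ⊓ c ≤ f Y := by
    intro s hs c hc X Y h
    refine (inf_le_inf_left _ hc).trans ?_
    rw [Finset.sup_inf_distrib_left]
    refine Finset.sup_le fun σ hσ => ?_
    obtain ⟨z, hz, rfl⟩ := mem_S.mp hσ
    rw [← map_inf]
    refine OrderHomClass.mono f fun x hx => ?_
    obtain ⟨y, hyx, hy⟩ := star hs hz hx.2
    exact (hyx.mem_iff Y).mp (h y ((hyx.mem_iff X).mpr hx.1) hy)
  have lower : ∀ s c, (∀ σ ∈ S s, f (A σ) ≤ c ⊔ f (B σ)) → ∀ X Y : OpK I D,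
      (∀ x ∈ (X : Set (J →₀ 𝕜)), x ∉ (Y : Set (J →₀ 𝕜)) →
        SignType.sign (linFunctional e x) = s) → f X ≤ f Y ⊔ c := by
    intro s c hc X Y h
    -- X and Y are unions of classes, so a point of X \ Y brings its whole class into X \ Y, where e
    -- has sign s.
    refine f.le_sup_of_subset_cover (S s) A B c hc X Y fun x hx hxY => cover fun y hyx => ?_
    exact h y ((hyx.mem_iff X).mpr hx) fun hy => hxY ((hyx.mem_iff Y).mp hy)
  obtain ⟨g, hg, hg'⟩ := f.exists_extension (K' := OpK I (D ∪ {e})) rfl hf_zero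
    (OpK_mono I Set.subset_union_left) {x | 0 < linFunctional e x} {x | linFunctional e x < 0}
    (by
      ext x
      simpa using fun h : 0 < linFunctional e x => h.le)
    (exists_normalForm_OpK I D e) a b hab
    (fun X Y h => lower 1 a ha X Y fun x hx hxY => sign_pos ((h hx).resolve_left hxY))
    (fun X Y h => lower (-1) b hb X Y fun x hx hxY => sign_neg ((h hx).resolve_left hxY))
    (fun X Y h => by
      refine f.le_sup_of_subset_cover (S 1 ∪ S (-1)) A B (a ⊔ b) (fun σ hσ => ?_) X Y
        fun x hx hxY => ?_
      · rcases Finset.mem_union.mp hσ with hσ | hσ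
        · exact (ha σ hσ).trans (sup_le_sup_right le_sup_left _)
        · exact (hb σ hσ).trans (sup_le_sup_right le_sup_right _)
      -- The class of x avoids the zeros of e, so by convexity e has constant sign on it.
      · have hne : ∀ y, SignEquiv (kkp 𝕜 I ∪ D) y x → linFunctional e y ≠ 0 := fun y hyx h0 => by
          rcases h ((hyx.mem_iff X).mpr hx) with hy | hy | hy
          · exact hxY ((hyx.mem_iff Y).mp hy)
          · exact hy.ne' h0
          · exact hy.ne h0
        rcases lt_or_gt_of_ne (hne x (SignEquiv.refl x)) with hlt | hgt
        · obtain ⟨σ, hσ, hσx⟩ := cover (s := -1) (x := x) fun y hyx => by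
            refine sign_neg ((hne y hyx).lt_or_gt.resolve_right fun hy => ?_)
            obtain ⟨z, hz, hz0⟩ := hyx.symm.exists_eq_zero hlt hy
            exact hne z hz hz0
          exact ⟨σ, Finset.mem_union_right _ hσ, hσx⟩
        · obtain ⟨σ, hσ, hσx⟩ := cover (s := 1) (x := x) fun y hyx => by
            refine sign_pos ((hne y hyx).lt_or_gt.resolve_left fun hy => ?_)
            obtain ⟨z, hz, hz0⟩ := hyx.exists_eq_zero hy hgt
            exact hne z (hz.trans hyx) hz0
          exact ⟨σ, Finset.mem_union_left _ hσ, hσx⟩)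
    (fun X Y h => upper 1 (by decide) a haA X Y fun x hx hs => h ⟨hx, sign_eq_one_iff.mp hs⟩)
    (fun X Y h => upper (-1) (by decide) b hbA X Y fun x hx hs =>
      h ⟨hx, sign_eq_neg_one_iff.mp hs⟩)
  refine ⟨g, ?_, hg⟩
  refine Set.ext fun U => ⟨fun hU => ?_, ?_⟩
  · obtain ⟨X, Y, Z, hXYZ, hgU⟩ := hg' U
    -- A join of elements below ∞ stays below ∞, so the term f X alone must reach it.
    have hX : X = ⊤ := by
      rw [← hf_top.eq_top_iff]
      by_contra hX
      refine WithTop.sup_ne_top (WithTop.sup_ne_top hX (ne_top_of_le_ne_top a_ne inf_le_right))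
        (ne_top_of_le_ne_top b_ne inf_le_right) (hgU.symm.trans hU)
    refine Subtype.ext (hXYZ.trans ?_)
    subst hX
    change Set.univ ∪ _ ∪ _ = Set.univ
    simp
  · rintro rfl
    exact (hg ⊤).trans (hf_top.eq_top_iff.mpr rfl)
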